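/- Let $n$ be a positive integer, let $B\ge 0$, and let $p\colon[0,1]^n\times[n+1]\to[0,B]$ be a profit function with $p(\cdot,i)$ measurable for each $i$. Let $\mathbf D=(D_1,\dots,D_n;\Pi)$ consist of probability distributions $D_1,\dots,D_n$ on $[0,1]$ and a distribution $\Pi$ on the permutations of $[n]$; write $(\mathbf X,\pi)\sim\mathbf D$ if $\pi\sim\Pi$ and $\mathbf X=(Y_{\pi(1)},\dots,Y_{\pi(n)})$, where $Y_1\sim D_1,\dots,Y_n\sim D_n$ and $\pi$ are independent. A deterministic online algorithm is a sequence $h=(f_i)_{i=1}^n$ of functions $f_i$, measurable in the values, that map the first $i$ values $x_1,\dots,x_i$ and indices $\tau(1),\dots,\tau(i)$ to $\{0,1\}$. Its profit on $(\boldsymbol x,\tau)$ is $h(\boldsymbol x,\tau)=p(\boldsymbol x,j)$, where $j\in[n]$ is the first step with $f_j=1$, and $j=n+1$ if there is none. Put $h(\mathbf D)=\mathbb E_{(\mathbf X,\pi)\sim\mathbf D}[h(\mathbf X,\pi)]$ and $\mathrm{Opt}_{\rm online}(\mathbf D)=\sup_h h(\mathbf D)$, the supremum being over all deterministic online algorithms.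 Let $\tilde{\mathcal H}$ be a set of deterministic online algorithms with $h(\mathbf D)=\mathrm{Opt}_{\rm online}(\mathbf D)$ for some $h\in\tilde{\mathcal H}$, let $t\ge 2$ be an integer, and let $$M_{t-1}=\sup\Bigl|\bigl\{\bigl(h(\boldsymbol x^{(1)},\tau^{(1)}),\dots,h(\boldsymbol x^{(t-1)},\tau^{(t-1)})\bigr) : h\in\tilde{\mathcal H}\bigr\}\Bigr|,$$ where the supremum is over all $\boldsymbol x^{(s)}\in[0,1]^n$ and all permutations $\tau^{(s)}$ that have positive probability under $\Pi$. Let $M\ge M_{t-1}$ be a real number. Then for all samples $S=\bigl((\boldsymbol x^{(s)},\tau^{(s)})\bigr)_{s=1}^{t-1}$ the empirical profit $\frac1{t-1}\sum_{s=1}^{t-1}h(\boldsymbol x^{(s)},\tau^{(s)})$ attains its maximum over $h\in\tilde{\mathcal H}$. Moreover, let $\hat h[S]\in\tilde{\mathcal H}$ be such a maximizer for every $S$, chosen measurably in the sense that $(S,(\boldsymbol x,\tau))\mapsto\hat h[S](\boldsymbol x,\tau)$ is measurable. Then, for $S$ consisting of $t-1$ i.i.d. samples from $\mathbf D$, $$\Pr_S\Bigl[\hat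 h[S](\mathbf D)\ \ge\ \mathrm{Opt}_{\rm online}(\mathbf D)-\epsilon_1(t)\Bigr]\ \ge\ 1-\frac1M,\qquad \epsilon_1(t)=6B\sqrt{\frac{2\ln(2M)}{t-1}} .$$ -/

import Mathlib

open MeasureTheory
open scoped ENNReal

/-- Permutations of a finite set of positions carry the discrete σ-algebra. -/
instance permMeasurableSpace (n : ℕ) : MeasurableSpace (Equiv.Perm (Fin n)) := ⊤

instance permDiscreteMeasurableSpace (n : ℕ) :
    DiscreteMeasurableSpace (Equiv.Perm (Fin n)) := ⟨fun _ => trivial⟩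

/-- A realization `(x, τ)`: the values in order of arrival, and the arrival order
(the value `x i` seen at step `i` is a draw from the `τ i`-th distribution). -/
abbrev Realization (n : ℕ) : Type := (Fin n → unitInterval) × Equiv.Perm (Fin n)

/-- The distributional data `D = (D_1, …, D_n; Π)`: probability distributions `D_i` on `[0,1]`
and a distribution `Π` on the permutations of the `n` positions. -/
structure StoppingDistribution (n : ℕ) where
  value : Fin n → ProbabilityMeasure unitInterval
  order : PMF (Equiv.Perm (Fin n))

/-- `(y, τ) ↦ ((y_{τ 1}, …, y_{τ n}), τ)`. -/
def arrange {n : ℕ} (q : (Fin n → unitInterval) × Equiv.Perm (Fin n)) : Realization n :=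
  (fun i => q.1 (q.2 i), q.2)

theorem measurable_arrange (n : ℕ) : Measurable (arrange (n := n)) := by
  refine measurable_from_prod_countable_left fun τ => ?_
  exact (measurable_pi_lambda _ fun i => measurable_pi_apply (τ i)).prodMk measurable_const

/-- The joint law of `(X, π)`: draw `Y_1, …, Y_n` and `π` independently from
`D_1, …, D_n` and `Π`, and put `X = (Y_{π 1}, …, Y_{π n})`. -/
noncomputable def StoppingDistribution.law {n : ℕ} (D : StoppingDistribution n) :
    Measure (Realization n) :=
  ((Measure.pi fun i => (D.value i : Measure unitInterval)).prod D.order.toMeasure).map arrange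

instance StoppingDistribution.isProbabilityMeasure_law {n : ℕ} (D : StoppingDistribution n) :
    IsProbabilityMeasure D.law :=
  Measure.isProbabilityMeasure_map (measurable_arrange n).aemeasurable

/-- A deterministic online algorithm: at step `i` it decides, from the values and the indices
seen so far, whether to accept the current value. The decision depends measurably on the
observed values. (With `Fin`, the step `i : Fin n` is the `(i+1)`-st one.) -/
structure OnlineAlgorithm (n : ℕ) where
  accept : (i : Fin n) → (Fin (i + 1) → unitInterval) → (Fin (i + 1) ↪ Fin n) → Bool
  measurable_accept : ∀ (i : Fin n) (σ : Fin (i + 1) ↪ Fin n),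
    Measurable fun x : Fin (i + 1) → unitInterval => accept i x σ

/-- The values `x_{≤ i}` seen up to and including step `i`. -/
def valuesUpTo {n : ℕ} (x : Fin n → unitInterval) (i : Fin n) : Fin (i + 1) → unitInterval :=
  fun j => x (Fin.castLE i.isLt j)

/-- The injection `τ_{≤ i}` of the indices seen up to and including step `i`. -/
def orderUpTo {n : ℕ} (τ : Equiv.Perm (Fin n)) (i : Fin n) : Fin (i + 1) ↪ Fin n :=
  (Fin.castLEEmb i.isLt).trans τ.toEmbedding

/-- The stopping position: the first step at which the algorithm accepts, or the extra last
position (`n + 1` in the usual numbering) if it rejects everything. -/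
def OnlineAlgorithm.stopIndex {n : ℕ} (h : OnlineAlgorithm n) (z : Realization n) : Fin (n + 1) :=
  (Finset.univ.filter fun i : Fin (n + 1) =>
    i = Fin.last n ∨ ∃ j : Fin n, j.castSucc = i ∧
      h.accept j (valuesUpTo z.1 j) (orderUpTo z.2 j) = true).min' ⟨Fin.last n, by simp⟩

/-- The profit `h(x, τ; p)`. -/
def OnlineAlgorithm.profit {n : ℕ} (h : OnlineAlgorithm n)
    (p : (Fin n → unitInterval) → Fin (n + 1) → ℝ) (z : Realization n) : ℝ :=
  p z.1 (h.stopIndex z)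

/-- The expected profit `h(D; p)`. -/
noncomputable def OnlineAlgorithm.expectedProfit {n : ℕ} (h : OnlineAlgorithm n)
    (p : (Fin n → unitInterval) → Fin (n + 1) → ℝ) (D : StoppingDistribution n) : ℝ :=
  ∫ z, h.profit p z ∂D.law

/-- The optimal online profit: the supremum of `h(D; p)` over all online algorithms. -/
noncomputable def optOnline {n : ℕ} (p : (Fin n → unitInterval) → Fin (n + 1) → ℝ)
    (D : StoppingDistribution n) : ℝ :=
  ⨆ h : OnlineAlgorithm n, h.expectedProfit p D

/-- The expected profit of `h` under the empirical distribution of the samples `S`. -/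
noncomputable def OnlineAlgorithm.empiricalProfit {n m : ℕ} (h : OnlineAlgorithm n)
    (p : (Fin n → unitInterval) → Fin (n + 1) → ℝ) (S : Fin m → Realization n) : ℝ :=
  (1 / (m : ℝ)) * ∑ s, h.profit p (S s)

/-- The algorithms of the class `H` that maximize the empirical profit over `H`. -/
def empiricalOptima {n m : ℕ} (p : (Fin n → unitInterval) → Fin (n + 1) → ℝ)
    (H : Set (OnlineAlgorithm n)) (S : Fin m → Realization n) : Set (OnlineAlgorithm n) :=
  {h | h ∈ H ∧ ∀ g ∈ H, g.empiricalProfit p S ≤ h.empiricalProfit p S}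

/-- The set of profit patterns `(h(x¹, τ¹; p), …, h(xᵐ, τᵐ; p))`, `h ∈ H`. -/
def profitPatterns {n m : ℕ} (p : (Fin n → unitInterval) → Fin (n + 1) → ℝ)
    (H : Set (OnlineAlgorithm n)) (S : Fin m → Realization n) : Set (Fin m → ℝ) :=
  (fun (h : OnlineAlgorithm n) (s : Fin m) => h.profit p (S s)) '' H

/-- The largest number of profit patterns on `m` realizations, over all value vectors in
`[0,1]^n` and all permutations that occur with positive probability. -/
noncomputable def maxProfitPatterns {n : ℕ} (p : (Fin n → unitInterval) → Fin (n + 1) → ℝ)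
    (H : Set (OnlineAlgorithm n)) (D : StoppingDistribution n) (m : ℕ) : ℕ∞ :=
  ⨆ (S : Fin m → Realization n) (_ : ∀ s, 0 < D.order (S s).2), (profitPatterns p H S).encard

/-! Compare the empirical maximizer with an optimal `g ∈ H` through `φ S z`, the profit of `hhat S`
at `z` minus that of `g`. Maximality makes the sample sum of `φ S` nonnegative, so a loss above `ε`
in expectation forces this sum to exceed `m` times its mean by at least `m * ε`. Only this upper
tail is needed.

Since `φ S` depends on the sample, independence cannot be used directly. Jensen's inequality
replaces the mean by a ghost sample, and exchanging any coordinates of sample and ghost preserves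
their joint law, so one may average over all `2 ^ m` exchanges (`integral_exp_ghost_le`). With the
pairs fixed, an exchange changes the selected algorithm as well as the signs, but the difference
vector before signing stays in a fixed set of at most `M ^ 2` vectors: at most `M` patterns on each
half. A union bound over this set leaves Rademacher sums, which are subgaussian, and Markov's
inequality finishes the proof. -/

/-- Exponential moment of a Rademacher sum with fixed coefficients. -/
theorem sum_bool_exp_signed_sum_le {m : ℕ} (l c : ℝ) (a : Fin m → ℝ) (ha : ∀ s, |a s| ≤ c) :
    ∑ σ : Fin m → Bool, Real.exp (l * ∑ s, (if σ s then a s else -a s)) ≤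
      2 ^ m * Real.exp (l ^ 2 * (m * c ^ 2) / 2) := by
  have key : ∑ σ : Fin m → Bool, Real.exp (l * ∑ s, (if σ s then a s else -a s)) =
      ∏ s, (2 * Real.cosh (l * a s)) := by
    have h := Finset.prod_univ_sum (fun _ : Fin m => (Finset.univ : Finset Bool))
      (fun s b => Real.exp (l * (if b then a s else -a s)))
    rw [Fintype.piFinset_univ] at h
    have h2 : ∀ s, ∑ b : Bool, Real.exp (l * (if b then a s else -a s)) =
        2 * Real.cosh (l * a s) := fun s => by
      rw [Fintype.sum_bool, Real.cosh_eq]; simp; ring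
    simp only [h2] at h
    rw [h]
    refine Finset.sum_congr rfl fun σ _ => ?_
    rw [Finset.mul_sum, Real.exp_sum]
  rw [key]
  calc ∏ s, (2 * Real.cosh (l * a s)) ≤ ∏ _s : Fin m, (2 * Real.exp (l ^ 2 * c ^ 2 / 2)) := by
        refine Finset.prod_le_prod (fun s _ => ?_) fun s _ => ?_
        · have := Real.cosh_pos (l * a s); positivity
        · refine mul_le_mul_of_nonneg_left ((Real.cosh_le_exp_half_sq _).trans ?_) (by norm_num)
          refine Real.exp_le_exp.2 ?_
          have : a s ^ 2 ≤ c ^ 2 := sq_le_sq.2 ((ha s).trans (le_abs_self c))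
          rw [mul_pow]
          gcongr
    _ = _ := by
        rw [Finset.prod_const, Finset.card_univ, Fintype.card_fin, mul_pow, ← Real.exp_nat_mul]
        congr 2; ring

/-- Coordinatewise exchange of a sample with its ghost sample. -/
def ghostSwap {Z : Type*} {m : ℕ} (σ : Fin m → Bool) (W : Fin m → Z × Z) : Fin m → Z × Z :=
  fun s => if σ s then W s else (W s).swap

/-- Each coordinate is either fixed or swapped, and `μ.prod μ` is symmetric. -/
theorem measurePreserving_ghostSwap {Z : Type*} [MeasurableSpace Z] {m : ℕ} (μ : Measure Z)
    [IsProbabilityMeasure μ] (σ : Fin m → Bool) :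
    MeasurePreserving (ghostSwap (Z := Z) σ)
      (Measure.pi fun _ => μ.prod μ) (Measure.pi fun _ => μ.prod μ) := by
  refine measurePreserving_pi (fun _ => μ.prod μ) (fun _ => μ.prod μ)
    (f := fun s w => if σ s then w else w.swap) fun s => ?_
  cases σ s
  · exact Measure.measurePreserving_swap
  · exact MeasurePreserving.id _

theorem abs_sum_sub_le {Z : Type*} {m : ℕ} (φ : (Fin m → Z) → Z → ℝ) {C : ℝ}
    (hC : ∀ S z, |φ S z| ≤ C) (T x y : Fin m → Z) :
    |∑ s, (φ T (x s) - φ T (y s))| ≤ m * (2 * C) := by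
  calc |∑ s, (φ T (x s) - φ T (y s))| ≤ ∑ s, |φ T (x s) - φ T (y s)| :=
        Finset.abs_sum_le_sum_abs _ _
    _ ≤ ∑ _s : Fin m, 2 * C := Finset.sum_le_sum fun s _ =>
        (abs_sub _ _).trans (by linarith [hC T (x s), hC T (y s)])
    _ = m * (2 * C) := by simp

/-! ### Symmetrization with a ghost sample -/

section Symmetrization

variable {Z : Type*} [MeasurableSpace Z] {m : ℕ} (μ : Measure Z) [IsProbabilityMeasure μ]
  (φ : (Fin m → Z) → Z → ℝ)

theorem measurable_sum_sub (hφ : Measurable fun q : (Fin m → Z) × Z => φ q.1 q.2) :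
    Measurable fun q : (Fin m → Z) × (Fin m → Z) =>
      ∑ s, (φ q.1 (q.1 s) - φ q.1 (q.2 s)) := by
  refine Finset.measurable_fun_sum _ fun s _ => ?_
  exact (hφ.comp (f := fun q : (Fin m → Z) × (Fin m → Z) => (q.1, q.1 s)) (by fun_prop)).sub
    (hφ.comp (f := fun q : (Fin m → Z) × (Fin m → Z) => (q.1, q.2 s)) (by fun_prop))

theorem integrable_exp_sum_sub (hφ : Measurable fun q : (Fin m → Z) × Z => φ q.1 q.2)
    {C : ℝ} (hC : ∀ S z, |φ S z| ≤ C) (l : ℝ) :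
    Integrable (fun q : (Fin m → Z) × (Fin m → Z) =>
      Real.exp (l * ∑ s, (φ q.1 (q.1 s) - φ q.1 (q.2 s))))
      ((Measure.pi fun _ => μ).prod (Measure.pi fun _ => μ)) := by
  refine Integrable.of_bound
    (Real.measurable_exp.comp ((measurable_sum_sub φ hφ).const_mul l)).aestronglyMeasurable
    (Real.exp (|l| * (m * (2 * C)))) (Filter.Eventually.of_forall fun q => ?_)
  rw [Real.norm_eq_abs, Real.abs_exp, Real.exp_le_exp]
  refine (le_abs_self _).trans ?_
  rw [abs_mul]
  gcongr
  exact abs_sum_sub_le φ hC _ _ _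

/-- Jensen's inequality replaces the mean by a ghost sample. -/
theorem exp_sum_sub_integral_le (hφ : Measurable fun q : (Fin m → Z) × Z => φ q.1 q.2)
    {C : ℝ} (hC : ∀ S z, |φ S z| ≤ C) (l : ℝ) (S : Fin m → Z) :
    Real.exp (l * (∑ s, φ S (S s) - m * ∫ z, φ S z ∂μ)) ≤
      ∫ S', Real.exp (l * ∑ s, (φ S (S s) - φ S (S' s))) ∂(Measure.pi fun _ : Fin m => μ) := by
  have hS : Measurable (φ S) := hφ.comp (f := fun z => (S, z)) (by fun_prop)
  have hi : ∀ s : Fin m, Integrable (fun S' : Fin m → Z => φ S (S' s))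
      (Measure.pi fun _ : Fin m => μ) := fun s =>
    Integrable.of_bound (hS.comp (measurable_pi_apply s)).aestronglyMeasurable C
      (Filter.Eventually.of_forall fun S' => hC _ _)
  have hX : Measurable fun S' : Fin m → Z => l * ∑ s, (φ S (S s) - φ S (S' s)) :=
    ((measurable_sum_sub φ hφ).comp (f := fun S' => (S, S')) (by fun_prop)).const_mul l
  have hint : ∫ S', l * ∑ s, (φ S (S s) - φ S (S' s)) ∂(Measure.pi fun _ : Fin m => μ) =
      l * (∑ s, φ S (S s) - m * ∫ z, φ S z ∂μ) := by
    have hd : ∀ s : Fin m, Integrable (fun S' : Fin m → Z => φ S (S s) - φ S (S' s))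
        (Measure.pi fun _ : Fin m => μ) := fun s => (integrable_const _).sub (hi s)
    rw [integral_const_mul, integral_finsetSum _ fun s _ => hd s]
    congr 1
    have h1 : ∀ s : Fin m, ∫ S', (φ S (S s) - φ S (S' s)) ∂(Measure.pi fun _ : Fin m => μ) =
        φ S (S s) - ∫ z, φ S z ∂μ := fun s => by
      rw [integral_sub (integrable_const _) (hi s),
        integral_comp_eval (μ := fun _ : Fin m => μ) (i := s) hS.aestronglyMeasurable]
      simp
    simp [h1, Finset.sum_sub_distrib]
  have hb : ∀ S' : Fin m → Z, |l * ∑ s, (φ S (S s) - φ S (S' s))| ≤ |l| * (m * (2 * C)) :=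
    fun S' => by
      rw [abs_mul]
      gcongr
      exact abs_sum_sub_le φ hC _ _ _
  rw [← hint]
  refine convexOn_exp.map_integral_le Real.continuous_exp.continuousOn isClosed_univ
    (Filter.Eventually.of_forall fun _ => Set.mem_univ _) ?_ ?_
  · exact Integrable.of_bound hX.aestronglyMeasurable _ (Filter.Eventually.of_forall hb)
  · refine Integrable.of_bound (Real.measurable_exp.comp hX).aestronglyMeasurable
      (Real.exp (|l| * (m * (2 * C)))) (Filter.Eventually.of_forall fun S' => ?_)
    rw [Function.comp_apply, Real.norm_eq_abs, Real.abs_exp, Real.exp_le_exp]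
    exact (le_abs_self _).trans (hb S')

/-- Symmetrization for a data-dependent function that takes few patterns on a sample and its
ghost. -/
theorem integral_exp_ghost_le (hφ : Measurable fun q : (Fin m → Z) × Z => φ q.1 q.2)
    {C : ℝ} (hC : ∀ S z, |φ S z| ≤ C) (l c N : ℝ)
    (hK : ∀ᵐ W ∂(Measure.pi fun _ : Fin m => μ.prod μ), ∃ K : Finset (Fin m → ℝ),
      (K.card : ℝ) ≤ N ∧ (∀ a ∈ K, ∀ s, |a s| ≤ c) ∧
        ∀ T : Fin m → Z, (fun s => φ T (W s).1 - φ T (W s).2) ∈ K) :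
    ∫ q, Real.exp (l * ∑ s, (φ q.1 (q.1 s) - φ q.1 (q.2 s)))
      ∂((Measure.pi fun _ : Fin m => μ).prod (Measure.pi fun _ : Fin m => μ)) ≤
      N * Real.exp (l ^ 2 * (m * c ^ 2) / 2) := by
  have hmp := measurePreserving_arrowProdEquivProdArrow Z Z (Fin m) (fun _ => μ) (fun _ => μ)
  have hI := integrable_exp_sum_sub μ φ hφ hC l
  rw [← hmp.integral_comp']
  set Ψ : (Fin m → Z × Z) → ℝ := fun W =>
    Real.exp (l * ∑ s, (φ (fun j => (W j).1) (W s).1 - φ (fun j => (W j).1) (W s).2)) with hΨ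
  have hIΨ : Integrable Ψ (Measure.pi fun _ : Fin m => μ.prod μ) :=
    hmp.integrable_comp_of_integrable hI
  change ∫ W, Ψ W ∂(Measure.pi fun _ : Fin m => μ.prod μ) ≤ _
  have hIσ : ∀ σ : Fin m → Bool, Integrable (fun W => Ψ (ghostSwap σ W))
      (Measure.pi fun _ : Fin m => μ.prod μ) := fun σ =>
    (measurePreserving_ghostSwap μ σ).integrable_comp_of_integrable hIΨ
  have hσ : ∀ σ : Fin m → Bool, ∫ W, Ψ (ghostSwap σ W) ∂(Measure.pi fun _ : Fin m => μ.prod μ) =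
      ∫ W, Ψ W ∂(Measure.pi fun _ : Fin m => μ.prod μ) := fun σ => by
    have h := (measurePreserving_ghostSwap μ σ)
    have h2 := integral_map h.measurable.aemeasurable (f := Ψ)
      (by rw [h.map_eq]; exact hIΨ.aestronglyMeasurable)
    rw [h.map_eq] at h2
    exact h2.symm
  have hsum : (2 : ℝ) ^ m * ∫ W, Ψ W ∂(Measure.pi fun _ : Fin m => μ.prod μ) =
      ∫ W, ∑ σ : Fin m → Bool, Ψ (ghostSwap σ W) ∂(Measure.pi fun _ : Fin m => μ.prod μ) := by
    rw [integral_finsetSum _ fun σ _ => hIσ σ]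
    simp [hσ]
  have hpt : ∀ᵐ W ∂(Measure.pi fun _ : Fin m => μ.prod μ),
      ∑ σ : Fin m → Bool, Ψ (ghostSwap σ W) ≤
        2 ^ m * (N * Real.exp (l ^ 2 * (m * c ^ 2) / 2)) := by
    filter_upwards [hK] with W ⟨K, hcard, hbd, hmem⟩
    calc ∑ σ : Fin m → Bool, Ψ (ghostSwap σ W)
        ≤ ∑ σ : Fin m → Bool, ∑ a ∈ K, Real.exp (l * ∑ s, (if σ s then a s else -a s)) := by
          refine Finset.sum_le_sum fun σ _ => ?_
          -- The sample after the exchange selects `T`. Since `K` serves every `T`, it does not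
          -- depend on `σ`, and the dependence of `φ` on the sample is absorbed by summing over `K`.
          have h := hmem fun j => (ghostSwap σ W j).1
          refine le_trans (le_of_eq ?_) (Finset.single_le_sum
            (f := fun a : Fin m → ℝ => Real.exp (l * ∑ s, (if σ s then a s else -a s)))
            (fun _ _ => (Real.exp_pos _).le) h)
          simp only [hΨ]
          congr 2
          refine Finset.sum_congr rfl fun s _ => ?_
          by_cases hs : σ s <;> simp [ghostSwap, hs]
      _ = ∑ a ∈ K, ∑ σ : Fin m → Bool, Real.exp (l * ∑ s, (if σ s then a s else -a s)) :=
          Finset.sum_comm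
      _ ≤ ∑ _a ∈ K, 2 ^ m * Real.exp (l ^ 2 * (m * c ^ 2) / 2) :=
          Finset.sum_le_sum fun a ha => sum_bool_exp_signed_sum_le l c a (hbd a ha)
      _ = K.card * (2 ^ m * Real.exp (l ^ 2 * (m * c ^ 2) / 2)) := by simp
      _ ≤ N * (2 ^ m * Real.exp (l ^ 2 * (m * c ^ 2) / 2)) := by gcongr
      _ = _ := by ring
  have hfin := integral_mono_ae (integrable_finsetSum _ fun σ _ => hIσ σ) (integrable_const _) hpt
  rw [← hsum, integral_const, probReal_univ, one_smul] at hfin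
  exact le_of_mul_le_mul_left hfin (by positivity)

/-- Uniform-convergence tail bound for a data-dependent function taking few patterns. -/
theorem measureReal_sum_sub_integral_ge_le (hφ : Measurable fun q : (Fin m → Z) × Z => φ q.1 q.2)
    {C : ℝ} (hC : ∀ S z, |φ S z| ≤ C) {l : ℝ} (hl : 0 ≤ l) (c N u : ℝ)
    (hK : ∀ᵐ W ∂(Measure.pi fun _ : Fin m => μ.prod μ), ∃ K : Finset (Fin m → ℝ),
      (K.card : ℝ) ≤ N ∧ (∀ a ∈ K, ∀ s, |a s| ≤ c) ∧
        ∀ T : Fin m → Z, (fun s => φ T (W s).1 - φ T (W s).2) ∈ K) :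
    (Measure.pi fun _ : Fin m => μ).real {S | u ≤ ∑ s, φ S (S s) - m * ∫ z, φ S z ∂μ} ≤
      N * Real.exp (l ^ 2 * (m * c ^ 2) / 2 - l * u) := by
  set ν := Measure.pi fun _ : Fin m => μ
  have hI := integrable_exp_sum_sub μ φ hφ hC l
  set J : (Fin m → Z) → ℝ := fun S => ∫ S', Real.exp (l * ∑ s, (φ S (S s) - φ S (S' s))) ∂ν with hJ
  have hJI : Integrable J ν := hI.integral_prod_left
  have hmarkov := mul_meas_ge_le_integral_of_nonneg (μ := ν) (f := J)
    (Filter.Eventually.of_forall fun S => integral_nonneg fun _ => (Real.exp_pos _).le) hJI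
    (Real.exp (l * u))
  have hJle : ∫ S, J S ∂ν ≤ N * Real.exp (l ^ 2 * (m * c ^ 2) / 2) := by
    rw [hJ, ← integral_prod _ hI]
    exact integral_exp_ghost_le μ φ hφ hC l c N hK
  have hsub : {S | u ≤ ∑ s, φ S (S s) - m * ∫ z, φ S z ∂μ} ⊆ {S | Real.exp (l * u) ≤ J S} :=
    fun S hS => (Real.exp_le_exp.2 (mul_le_mul_of_nonneg_left hS hl)).trans
      (exp_sum_sub_integral_le μ φ hφ hC l S)
  rw [Real.exp_sub, ← mul_div_assoc, le_div_iff₀' (Real.exp_pos _)]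
  exact (mul_le_mul_of_nonneg_left (measureReal_mono hsub) (Real.exp_pos _).le).trans
    (hmarkov.trans hJle)

end Symmetrization

/-! ### Measurability, profit patterns and empirical maximizers -/

section OnlineAlgorithms

variable {n : ℕ} {B : ℝ} {p : (Fin n → unitInterval) → Fin (n + 1) → ℝ}

theorem measurable_valuesUpTo (i : Fin n) :
    Measurable fun x : Fin n → unitInterval => valuesUpTo x i :=
  measurable_pi_lambda _ fun j => measurable_pi_apply (Fin.castLE i.isLt j)

theorem OnlineAlgorithm.measurable_stopIndex (h : OnlineAlgorithm n) : Measurable h.stopIndex := by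
  have hacc : Measurable fun (z : Realization n) (j : Fin n) =>
      h.accept j (valuesUpTo z.1 j) (orderUpTo z.2 j) := by
    refine measurable_pi_lambda _ fun j => measurable_from_prod_countable_left fun τ => ?_
    exact (h.measurable_accept j (orderUpTo τ j)).comp (measurable_valuesUpTo j)
  -- The stopping index is a function of the finite vector of all decisions, and any function on a
  -- finite discrete space is measurable.
  exact (measurable_of_countable fun b : Fin n → Bool =>
    (Finset.univ.filter fun i : Fin (n + 1) =>
      i = Fin.last n ∨ ∃ j : Fin n, j.castSucc = i ∧ b j = true).min' ⟨Fin.last n, by simp⟩).comp hacc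

theorem OnlineAlgorithm.measurable_profit (hp_meas : ∀ i, Measurable fun x => p x i)
    (h : OnlineAlgorithm n) : Measurable (h.profit p) := by
  have hp : Measurable fun q : (Fin n → unitInterval) × Fin (n + 1) => p q.1 q.2 :=
    measurable_from_prod_countable_left hp_meas
  exact hp.comp (measurable_fst.prodMk h.measurable_stopIndex)

theorem finite_profitPatterns {m : ℕ} (H : Set (OnlineAlgorithm n))
    (S : Fin m → Realization n) : (profitPatterns p H S).Finite := by
  refine (Set.finite_range fun (j : Fin m → Fin (n + 1)) (s : Fin m) => p (S s).1 (j s)).subset ?_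
  rintro _ ⟨h, -, rfl⟩
  exact ⟨fun s => h.stopIndex (S s), rfl⟩

/-- The empirical profit depends only on the profit pattern, and a fixed sample has finitely many
patterns because each entry is determined by a stopping index. -/
theorem empiricalOptima_nonempty {m : ℕ} {H : Set (OnlineAlgorithm n)} (hH : H.Nonempty)
    (S : Fin m → Realization n) : (empiricalOptima p H S).Nonempty := by
  obtain ⟨v, ⟨h, hh, rfl⟩, hmax⟩ := Set.exists_max_image (profitPatterns p H S)
    (fun v => (1 / (m : ℝ)) * ∑ s, v s) (finite_profitPatterns H S) (hH.image _)
  exact ⟨h, hh, fun g hg => hmax _ ⟨g, hg, rfl⟩⟩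

/-- The pattern count is controlled only on orders of positive probability; this makes it applicable
to almost every sample and ghost. -/
theorem StoppingDistribution.ae_order_pos (D : StoppingDistribution n) :
    ∀ᵐ z ∂D.law, 0 < D.order z.2 := by
  have h1 : ∀ᵐ τ ∂D.order.toMeasure, 0 < D.order τ := by
    rw [ae_iff, PMF.toMeasure_apply_eq_zero_iff _ (MeasurableSet.of_discrete)]
    rw [Set.disjoint_left]
    intro τ hτ hτ'
    exact hτ' (pos_iff_ne_zero.2 ((PMF.mem_support_iff _ _).1 hτ))
  rw [StoppingDistribution.law]
  refine (ae_map_iff (measurable_arrange n).aemeasurable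
    ((MeasurableSet.of_discrete (s := {τ | 0 < D.order τ})).preimage measurable_snd)).2 ?_
  exact Measure.quasiMeasurePreserving_snd.ae h1

theorem encard_profitPatterns_le {m : ℕ} {H : Set (OnlineAlgorithm n)}
    {D : StoppingDistribution n} {S : Fin m → Realization n} (hS : ∀ s, 0 < D.order (S s).2) :
    (profitPatterns p H S).encard ≤ maxProfitPatterns p H D m :=
  le_iSup₂_of_le S hS le_rfl

theorem ncard_profitPatterns_le {m : ℕ} {H : Set (OnlineAlgorithm n)}
    {D : StoppingDistribution n} {M : ℝ} (hM0 : 0 ≤ M)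
    (hM : (maxProfitPatterns p H D m : ℝ≥0∞) ≤ ENNReal.ofReal M)
    {S : Fin m → Realization n} (hS : ∀ s, 0 < D.order (S s).2) :
    ((finite_profitPatterns (p := p) H S).toFinset.card : ℝ) ≤ M := by
  have h1 := (ENat.toENNReal_le.2 (encard_profitPatterns_le (p := p) (H := H) hS)).trans hM
  rw [(finite_profitPatterns H S).encard_eq_coe_toFinset_card, ENat.toENNReal_coe,
    ← ENNReal.ofReal_natCast, ENNReal.ofReal_le_ofReal_iff hM0] at h1
  exact h1

theorem one_le_of_maxProfitPatterns_le {m : ℕ} {H : Set (OnlineAlgorithm n)} (hH : H.Nonempty)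
    {D : StoppingDistribution n} {M : ℝ}
    (hM : (maxProfitPatterns p H D m : ℝ≥0∞) ≤ ENNReal.ofReal M) : 1 ≤ M := by
  obtain ⟨τ, hτ⟩ := D.order.support_nonempty
  have h1 : (1 : ℕ∞) ≤ maxProfitPatterns p H D m :=
    (Set.one_le_encard_iff_nonempty.2 (hH.image _)).trans
      (encard_profitPatterns_le (S := fun _ => (fun _ => 0, τ))
        fun _ => pos_iff_ne_zero.2 ((PMF.mem_support_iff _ _).1 hτ))
  have h2 := (ENat.toENNReal_le.2 h1).trans hM
  rw [ENat.toENNReal_one] at h2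
  exact ENNReal.one_le_ofReal.1 h2

/-- On a sample and its ghost, the profit differences of the algorithms in `H` relative to a fixed
algorithm take at most `M ^ 2` patterns. -/
theorem exists_finset_profit_differences {m : ℕ} {H : Set (OnlineAlgorithm n)}
    (hp_range : ∀ x i, p x i ∈ Set.Icc 0 B) {D : StoppingDistribution n} {M : ℝ} (hM0 : 0 ≤ M)
    (hM : (maxProfitPatterns p H D m : ℝ≥0∞) ≤ ENNReal.ofReal M) (g : OnlineAlgorithm n)
    {W : Fin m → Realization n × Realization n}
    (hW : ∀ s, 0 < D.order (W s).1.2 ∧ 0 < D.order (W s).2.2) :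
    ∃ K : Finset (Fin m → ℝ), (K.card : ℝ) ≤ M ^ 2 ∧ (∀ a ∈ K, ∀ s, |a s| ≤ 2 * B) ∧
      ∀ h ∈ H, (fun s => (h.profit p (W s).1 - g.profit p (W s).1) -
        (h.profit p (W s).2 - g.profit p (W s).2)) ∈ K := by
  classical
  set P := finite_profitPatterns (p := p) H fun s => (W s).1
  set Q := finite_profitPatterns (p := p) H fun s => (W s).2
  -- Patterns on the two halves are paired freely, possibly from different algorithms; this costs
  -- the square of `M`. Profits in `[0, B]` still keep every entry within `2 * B`, since two of the
  -- four terms enter with each sign.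
  refine ⟨(P.toFinset ×ˢ Q.toFinset).image fun v s =>
    (v.1 s - g.profit p (W s).1) - (v.2 s - g.profit p (W s).2), ?_, ?_, ?_⟩
  · refine (Nat.cast_le.2 Finset.card_image_le).trans ?_
    rw [Finset.card_product, Nat.cast_mul, pow_two]
    exact mul_le_mul (ncard_profitPatterns_le hM0 hM fun s => (hW s).1)
      (ncard_profitPatterns_le hM0 hM fun s => (hW s).2) (Nat.cast_nonneg _) hM0
  · intro a ha s
    simp only [Finset.mem_image, Finset.mem_product, Set.Finite.mem_toFinset] at ha
    obtain ⟨⟨_, _⟩, ⟨⟨h, -, rfl⟩, ⟨h', -, rfl⟩⟩, rfl⟩ := ha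
    have h1 := hp_range (W s).1.1 (h.stopIndex (W s).1)
    have h2 := hp_range (W s).1.1 (g.stopIndex (W s).1)
    have h3 := hp_range (W s).2.1 (h'.stopIndex (W s).2)
    have h4 := hp_range (W s).2.1 (g.stopIndex (W s).2)
    simp only [OnlineAlgorithm.profit, Set.mem_Icc] at *
    rw [abs_le]
    constructor <;> linarith
  · intro h hh
    exact Finset.mem_image.2 ⟨(fun s => h.profit p (W s).1, fun s => h.profit p (W s).2),
      Finset.mem_product.2 ⟨P.mem_toFinset.2 ⟨h, hh, rfl⟩, Q.mem_toFinset.2 ⟨h, hh, rfl⟩⟩, rfl⟩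

/-- An empirical maximizer over `H` is far from a given member of `H` only with exponentially small
probability. -/
theorem measureReal_empirical_maximizer_bad_le {m : ℕ} (hm : 0 < m)
    {H : Set (OnlineAlgorithm n)}
    (hp_range : ∀ x i, p x i ∈ Set.Icc 0 B) (hp_meas : ∀ i, Measurable fun x => p x i)
    {D : StoppingDistribution n} {M : ℝ} (hM0 : 0 ≤ M)
    (hM : (maxProfitPatterns p H D m : ℝ≥0∞) ≤ ENNReal.ofReal M)
    {g : OnlineAlgorithm n} (hg : g ∈ H)
    {hhat : (Fin m → Realization n) → OnlineAlgorithm n}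
    (hopt : ∀ S, hhat S ∈ empiricalOptima p H S)
    (hmeas : Measurable fun q : (Fin m → Realization n) × Realization n =>
      (hhat q.1).profit p q.2) {l : ℝ} (hl : 0 ≤ l) (ε : ℝ) :
    (Measure.pi fun _ : Fin m => D.law).real
      {S | (hhat S).expectedProfit p D < g.expectedProfit p D - ε} ≤
      M ^ 2 * Real.exp (l ^ 2 * (m * (2 * B) ^ 2) / 2 - l * (m * ε)) := by
  have hC : ∀ (h : OnlineAlgorithm n) z, |h.profit p z| ≤ B := fun h z => by
    have := hp_range z.1 (h.stopIndex z)
    rw [OnlineAlgorithm.profit, abs_of_nonneg this.1]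
    exact this.2
  have hint : ∀ h : OnlineAlgorithm n, Integrable (h.profit p) D.law := fun h =>
    Integrable.of_bound (h.measurable_profit hp_meas).aestronglyMeasurable B
      (Filter.Eventually.of_forall (hC h))
  set φ : (Fin m → Realization n) → Realization n → ℝ :=
    fun S z => (hhat S).profit p z - g.profit p z with hφdef
  have hφ : Measurable fun q : (Fin m → Realization n) × Realization n => φ q.1 q.2 :=
    hmeas.sub ((g.measurable_profit hp_meas).comp measurable_snd)
  have hφC : ∀ S z, |φ S z| ≤ 2 * B := fun S z =>
    (abs_sub _ _).trans (by linarith [hC (hhat S) z, hC g z])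
  refine le_trans (measureReal_mono ?_) (measureReal_sum_sub_integral_ge_le D.law φ hφ hφC hl
    (2 * B) (M ^ 2) (m * ε) ?_)
  · intro S hS
    have hm' : (0 : ℝ) < m := Nat.cast_pos.2 hm
    -- Empirical maximality is used here, against the competitor `g`.
    have h1 : 0 ≤ ∑ s, φ S (S s) := by
      have h := (hopt S).2 g hg
      rw [OnlineAlgorithm.empiricalProfit, OnlineAlgorithm.empiricalProfit] at h
      have := le_of_mul_le_mul_left h (by positivity)
      simp only [hφdef, Finset.sum_sub_distrib]
      linarith
    have h2 : ∫ z, φ S z ∂D.law = (hhat S).expectedProfit p D - g.expectedProfit p D :=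
      integral_sub (hint _) (hint _)
    simp only [Set.mem_ofPred_eq] at hS ⊢
    rw [h2]
    nlinarith
  · have hpos : ∀ᵐ w ∂D.law.prod D.law, 0 < D.order w.1.2 ∧ 0 < D.order w.2.2 :=
      (Measure.quasiMeasurePreserving_fst.ae D.ae_order_pos).and
        (Measure.quasiMeasurePreserving_snd.ae D.ae_order_pos)
    have hall : ∀ᵐ W ∂(Measure.pi fun _ : Fin m => D.law.prod D.law), ∀ s,
        0 < D.order (W s).1.2 ∧ 0 < D.order (W s).2.2 :=
      ae_all_iff.2 fun s => (Measure.tendsto_eval_ae_ae (μ := fun _ : Fin m => D.law.prod D.law)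
        (i := s)).eventually hpos
    filter_upwards [hall] with W hW
    obtain ⟨K, hK1, hK2, hK3⟩ := exists_finset_profit_differences hp_range hM0 hM g hW
    exact ⟨K, hK1, hK2, fun T => hK3 _ (hopt T).1⟩

end OnlineAlgorithms

/-! ### Choice of constants and conclusion -/

theorem sq_mul_exp_neg_log_le {M : ℝ} (hM : 1 ≤ M) :
    M ^ 2 * Real.exp (-(8 * Real.log (2 * M))) ≤ 1 / M := by
  have h : Real.exp (-(8 * Real.log (2 * M))) = ((2 * M) ^ 8)⁻¹ := by
    rw [Real.exp_neg, mul_comm, Real.exp_mul, Real.exp_log (by positivity)]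
    norm_cast
  rw [h, ← div_eq_mul_inv, div_le_div_iff₀ (by positivity) (by positivity), one_mul]
  calc M ^ 2 * M = M ^ 3 := by ring
    _ ≤ M ^ 8 := pow_le_pow_right₀ hM (by norm_num)
    _ ≤ (2 * M) ^ 8 := pow_le_pow_left₀ (by positivity) (by linarith) 8

theorem mainTheorem6 {n : ℕ} (B : ℝ)
    (p : (Fin n → unitInterval) → Fin (n + 1) → ℝ)
    (hp_range : ∀ x i, p x i ∈ Set.Icc 0 B)
    (hp_meas : ∀ i, Measurable fun x => p x i)
    (D : StoppingDistribution n)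
    (H : Set (OnlineAlgorithm n))
    (hH : ∃ h ∈ H, h.expectedProfit p D = optOnline p D)
    (t : ℕ) (ht : 2 ≤ t)
    (M : ℝ) (hM : (maxProfitPatterns p H D (t - 1) : ℝ≥0∞) ≤ ENNReal.ofReal M) :
    (∀ S : Fin (t - 1) → Realization n, (empiricalOptima p H S).Nonempty) ∧
    ∀ hhat : (Fin (t - 1) → Realization n) → OnlineAlgorithm n,
      (∀ S, hhat S ∈ empiricalOptima p H S) →
      Measurable (fun q : (Fin (t - 1) → Realization n) × Realization n =>
        (hhat q.1).profit p q.2) →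
      1 - 1 / M ≤ (Measure.pi fun _ : Fin (t - 1) => D.law).real
        {S | optOnline p D - 6 * B * Real.sqrt (2 * Real.log (2 * M) / ((t : ℝ) - 1))
          ≤ (hhat S).expectedProfit p D} := by
  obtain ⟨g, hg, hgopt⟩ := hH
  refine ⟨fun S => empiricalOptima_nonempty ⟨g, hg⟩ S, fun hhat hopt hmeas => ?_⟩
  have hM1 : 1 ≤ M := one_le_of_maxProfitPatterns_le ⟨g, hg⟩ hM
  have htm : (t : ℝ) - 1 = ((t - 1 : ℕ) : ℝ) := by
    rw [Nat.cast_sub (by omega), Nat.cast_one]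
  have hm : 0 < t - 1 := by omega
  rw [htm, ← hgopt]
  generalize t - 1 = m at *
  have hm' : (0 : ℝ) < m := Nat.cast_pos.2 hm
  set L := Real.log (2 * M)
  have hL : 0 ≤ L := Real.log_nonneg (by linarith)
  set r := Real.sqrt (2 * L / m)
  have hr : r ^ 2 * m = 2 * L := by
    rw [Real.sq_sqrt (by positivity)]
    field_simp
  have hmeasA : MeasurableSet {S | g.expectedProfit p D - 6 * B * r ≤
      (hhat S).expectedProfit p D} :=
    -- The expected profit of the selected algorithm is a measurable function of the sample by
    -- Fubini, from joint measurability of the selection.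
    measurableSet_le measurable_const
      (hmeas.stronglyMeasurable.integral_prod_right (ν := D.law)).measurable
  have hcompl : {S | g.expectedProfit p D - 6 * B * r ≤ (hhat S).expectedProfit p D}ᶜ =
      {S | (hhat S).expectedProfit p D < g.expectedProfit p D - 6 * B * r} := by
    ext S; simp only [Set.mem_compl_iff, Set.mem_ofPred_eq, not_le]
  suffices hbad : (Measure.pi fun _ : Fin m => D.law).real
      {S | (hhat S).expectedProfit p D < g.expectedProfit p D - 6 * B * r} ≤ 1 / M by
    rw [← hcompl, probReal_compl_eq_one_sub hmeasA] at hbad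
    linarith
  have hB : 0 ≤ B := (hp_range (fun _ => 0) 0).1.trans (hp_range (fun _ => 0) 0).2
  -- The parameter `l = r / B` below needs `B ≠ 0`; for `B = 0` every profit vanishes.
  rcases hB.eq_or_lt with rfl | hB
  · have h0 : ∀ h : OnlineAlgorithm n, h.expectedProfit p D = 0 := fun h => by
      have : h.profit p = fun _ => 0 := funext fun z =>
        le_antisymm (hp_range z.1 (h.stopIndex z)).2 (hp_range z.1 (h.stopIndex z)).1
      simp [OnlineAlgorithm.expectedProfit, this]
    simp only [h0]
    simp
    positivity
  -- With `l = r / B` and `ε = 6 * B * r` the exponent is `2 * r ^ 2 * m - 6 * r ^ 2 * m = -8 * L`,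
  -- and the factor `(2 * M) ^ (-8)` more than compensates for `M ^ 2`.
  · have h := measureReal_empirical_maximizer_bad_le hm hp_range hp_meas (by linarith) hM hg hopt
      hmeas (l := r / B) (by positivity) (6 * B * r)
    refine h.trans ((le_of_eq ?_).trans (sq_mul_exp_neg_log_le hM1))
    congr 2
    have h1 : (r / B) ^ 2 * (m * (2 * B) ^ 2) / 2 - r / B * (m * (6 * B * r)) =
        -(4 * (r ^ 2 * m)) := by
      field_simp
      ring
    rw [h1, hr]
    ring
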